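/- (i) Let $p>1$ be an odd integer. Then $p$ is a prime with $p\equiv 3\pmod 4$ if and only if there are no odd integers $x,y,z$ such that $p^2=x^2+8(y^2+z^2)$. (ii) Let $n>1$ be an odd integer. Then every (positive) prime divisor of $n$ is congruent to $1$ modulo $4$ if and only if there are no odd integers $x,y,z$ such that $n^2=x^2+4(y^2+z^2)$. -/

import Mathlib

/-!
Writing `a = (n - x) / 2` and `b = (n + x) / 2`, a representation `n² = x² + 4 s` is the same thing
as a splitting `n = a + b` with `a * b = s`. Both parts of the theorem are therefore about writing
an odd number as a sum `a + b` for which `a * b` is a sum of two squares with a prescribed power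
of `2`.

*Non-existence.* If no prime `q ≡ 3 (mod 4)` divides both `a` and `b`, then the two-squares theorem
makes `a` and `b` themselves sums of two squares (`Nat.eq_sq_add_sq_of_mul`). The residues modulo
`4` of sums of two squares then contradict that of `a + b`
(`Int.sum_two_sq_of_sq_eq_sq_add_four_mul`). For a prime `p ≡ 3 (mod 4)` the hypothesis holds
because `0 < a, b < p`; for `n` with only prime factors `≡ 1 (mod 4)` it holds because a common
divisor of `a` and `b` divides `n`.

*Existence.* Representations scale by odd factors, so it suffices to represent a suitable divisor.
For the form `x² + 4 (y² + z²)` this is a prime `q ≡ 3 (mod 4)`: in Lagrange's representation of `q`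
as a sum of four squares exactly three are odd, and grouping them in pairs gives the splitting
(`Int.exists_sq_eq_sq_add_four_mul`).
For `x² + 8 (y² + z²)` it is any divisor `d > 1` with `d ≡ 1 (mod 4)`; a composite `p ≡ 3 (mod 4)`
has one. With `u = 1` or `u = 3` the number `m = (d - u²) / 4` is positive and `≡ 1` or `2 (mod 4)`,
hence a sum of three squares, not all of the same parity, and `d = (u² + 4 a²) + 4 (b² + c²)` with
`b² + c²` odd is the splitting (`Int.exists_sq_eq_sq_add_eight_mul`).

The three-squares theorem for `m ≡ 1, 2 (mod 4)` (`Nat.exists_sum_three_sq`) is proved as follows.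
Dirichlet's theorem and quadratic reciprocity give a prime `p ≡ 1 (mod 4)`, `p ≡ -1 (mod m)`, modulo
which `m` is a square. A pigeonhole argument solves `m T² = U² + p V²` with `T ≠ 0`; as `p` is a sum
of two squares, `m` is a sum of three rational squares, and the descent of Davenport and Cassels
(`Int.exists_sum_three_sq_of_mul_sq`) makes them integral.
-/

/-! ### Sums of three squares -/

/-- The integer `round (x / t)`, characterised by a small remainder. -/
theorem Int.exists_four_mul_sq_sub_mul_le (x t : ℤ) (ht : 0 < t) :
    ∃ a : ℤ, 4 * (x - a * t) ^ 2 ≤ t ^ 2 := by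
  refine ⟨(2 * x + t) / (2 * t), ?_⟩
  have h1 := Int.emod_add_mul_ediv (2 * x + t) (2 * t)
  have h2 := Int.emod_nonneg (2 * x + t) (b := 2 * t) (by omega)
  have h3 := Int.emod_lt_of_pos (2 * x + t) (b := 2 * t) (by omega)
  have h4 : |2 * (x - (2 * x + t) / (2 * t) * t)| ≤ |t| := by
    rw [abs_of_pos ht, abs_le]
    constructor <;> linarith
  have h5 := sq_le_sq.mpr h4
  linarith

/-- Davenport–Cassels: a sum of three rational squares that is an integer is a sum of three integer
squares. The line through the rational point `(x, y, z) / t` and the nearest integer point meets the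
sphere again in a point of smaller denominator. -/
theorem Int.exists_sum_three_sq_of_mul_sq (m : ℤ) (t : ℕ) (ht : 0 < t) (x y z : ℤ)
    (h : m * (t : ℤ) ^ 2 = x ^ 2 + y ^ 2 + z ^ 2) :
    ∃ a b c : ℤ, m = a ^ 2 + b ^ 2 + c ^ 2 := by
  induction t using Nat.strong_induction_on generalizing x y z with
  | _ t ih =>
    have ht' : (0 : ℤ) < t := by exact_mod_cast ht
    obtain ⟨a, ha⟩ := Int.exists_four_mul_sq_sub_mul_le x t ht'
    obtain ⟨b, hb⟩ := Int.exists_four_mul_sq_sub_mul_le y t ht'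
    obtain ⟨c, hc⟩ := Int.exists_four_mul_sq_sub_mul_le z t ht'
    obtain ⟨N, hN⟩ : ∃ N, N = a ^ 2 + b ^ 2 + c ^ 2 - m := ⟨_, rfl⟩
    -- The new denominator `s` satisfies `s / t = |(x, y, z) / t - (a, b, c)|²`.
    obtain ⟨s, hs⟩ : ∃ s, s = t * (m + a ^ 2 + b ^ 2 + c ^ 2) - 2 * (a * x + b * y + c * z) :=
      ⟨_, rfl⟩
    have hR : (x - a * t) ^ 2 + (y - b * t) ^ 2 + (z - c * t) ^ 2 = t * s := by
      rw [hs]; linear_combination -h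
    have hs0 : 0 ≤ s := by
      by_contra hneg
      have : (t : ℤ) * s < 0 := mul_neg_of_pos_of_neg ht' (by omega)
      linarith [sq_nonneg (x - a * t), sq_nonneg (y - b * t), sq_nonneg (z - c * t)]
    have hst : s < t := by
      by_contra hge
      have h1 : (t : ℤ) * t ≤ t * s := mul_le_mul_of_nonneg_left (by omega) ht'.le
      have h2 : (0 : ℤ) < t * t := mul_pos ht' ht'
      linarith [sq_nonneg (t : ℤ)]
    rcases hs0.eq_or_lt with h0 | hpos
    · rw [← h0, mul_zero] at hR
      have hx : x - a * t = 0 := by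
        apply pow_eq_zero_iff (two_ne_zero) |>.mp
        linarith [sq_nonneg (x - a * t), sq_nonneg (y - b * t), sq_nonneg (z - c * t)]
      have hy : y - b * t = 0 := by
        apply pow_eq_zero_iff (two_ne_zero) |>.mp
        linarith [sq_nonneg (x - a * t), sq_nonneg (y - b * t), sq_nonneg (z - c * t)]
      have hz : z - c * t = 0 := by
        apply pow_eq_zero_iff (two_ne_zero) |>.mp
        linarith [sq_nonneg (x - a * t), sq_nonneg (y - b * t), sq_nonneg (z - c * t)]
      refine ⟨a, b, c, mul_right_cancel₀ (pow_ne_zero 2 ht'.ne') (h.trans ?_)⟩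
      rw [sub_eq_zero.mp hx, sub_eq_zero.mp hy, sub_eq_zero.mp hz]
      ring
    · lift s to ℕ using hs0
      refine ih s (by exact_mod_cast hst) (by exact_mod_cast hpos)
        (a * s + N * (x - a * t)) (b * s + N * (y - b * t)) (c * s + N * (z - c * t)) ?_
      linear_combination (-N ^ 2) * hR + (-N * s) * hs
        + ((s : ℤ) ^ 2 - N * s * t) * hN

/-- A solution of `m T² = U² + p V²`: the pigeonhole principle gives a small nonzero `(X, Y, Z)` with
`Z ≡ Y (mod m)` and `Z² ≡ m X² (mod p)`, for which `Z² + p Y² - m X²` is a multiple of `m p` lying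
strictly between `-m p` and `2 m p`. The value `m p` is reduced to the value `0` by multiplying
`m (X² + p) = Z² + p Y²` by the norm `X² + p`. -/
theorem Nat.exists_mul_sq_eq_sq_add_mul_sq {m p : ℕ} (hp : p.Prime) (hm0 : 0 < m)
    (hm : ¬ IsSquare m) (hmp : m < p) (hpm : m ∣ p + 1) (hsq : IsSquare (m : ZMod p)) :
    ∃ T U V : ℤ, T ≠ 0 ∧ m * T ^ 2 = U ^ 2 + p * V ^ 2 := by
  have : NeZero m := ⟨hm0.ne'⟩
  have : NeZero p := ⟨hp.ne_zero⟩
  obtain ⟨r, hr⟩ := hsq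
  let f : Fin (p.sqrt + 1) × Fin (m.sqrt + 1) × Fin ((m * p).sqrt + 1) → ZMod m × ZMod p :=
    fun v => (((v.2.2 : ℕ) : ZMod m) - ((v.2.1 : ℕ) : ZMod m),
      ((v.2.2 : ℕ) : ZMod p) - r * ((v.1 : ℕ) : ZMod p))
  have hcard : Fintype.card (ZMod m × ZMod p) <
      Fintype.card (Fin (p.sqrt + 1) × Fin (m.sqrt + 1) × Fin ((m * p).sqrt + 1)) := by
    simp only [Fintype.card_prod, ZMod.card, Fintype.card_fin]
    refine lt_of_pow_lt_pow_left₀ 2 (Nat.zero_le _) ?_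
    have h1 : p < (p.sqrt + 1) ^ 2 := Nat.lt_succ_sqrt' p
    have h2 : m < (m.sqrt + 1) ^ 2 := Nat.lt_succ_sqrt' m
    have h3 : m * p < ((m * p).sqrt + 1) ^ 2 := Nat.lt_succ_sqrt' (m * p)
    calc (m * p) ^ 2 = p * (m * (m * p)) := by ring
      _ < (p.sqrt + 1) ^ 2 * ((m.sqrt + 1) ^ 2 * ((m * p).sqrt + 1) ^ 2) := by gcongr
      _ = _ := by ring
  obtain ⟨⟨x₁, y₁, z₁⟩, ⟨x₂, y₂, z₂⟩, hne, hf⟩ := Fintype.exists_ne_map_eq_of_card_lt f hcard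
  simp only [f, Prod.mk.injEq] at hf
  have hbound : ∀ (n : ℕ) (u v : Fin (n.sqrt + 1)),
      (((u : ℕ) : ℤ) - ((v : ℕ) : ℤ)) ^ 2 ≤ (n : ℤ) := by
    intro n u v
    have h1 := u.2
    have h2 := v.2
    have h3 : (((u : ℕ) : ℤ) - ((v : ℕ) : ℤ)) ^ 2 ≤ (n.sqrt : ℤ) ^ 2 := by
      apply sq_le_sq.mpr
      rw [abs_of_nonneg (by positivity : (0 : ℤ) ≤ (n.sqrt : ℤ)), abs_le]
      constructor <;> omega
    exact h3.trans (by exact_mod_cast Nat.sqrt_le' n)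
  obtain ⟨X, hX⟩ : ∃ X : ℤ, X = ((x₁ : ℕ) : ℤ) - ((x₂ : ℕ) : ℤ) := ⟨_, rfl⟩
  obtain ⟨Y, hY⟩ : ∃ Y : ℤ, Y = ((y₁ : ℕ) : ℤ) - ((y₂ : ℕ) : ℤ) := ⟨_, rfl⟩
  obtain ⟨Z, hZ⟩ : ∃ Z : ℤ, Z = ((z₁ : ℕ) : ℤ) - ((z₂ : ℕ) : ℤ) := ⟨_, rfl⟩
  have hXb : X ^ 2 ≤ p := hX ▸ hbound p x₁ x₂
  have hYb : Y ^ 2 ≤ m := hY ▸ hbound m y₁ y₂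
  have hZb : Z ^ 2 ≤ m * p := by
    have := hbound (m * p) z₁ z₂
    rw [← hZ] at this
    exact_mod_cast this
  have hXlt : X ^ 2 < p := by
    refine lt_of_le_of_ne hXb fun h => hp.not_isSquare ⟨X.natAbs, ?_⟩
    zify
    rw [← h, ← sq, sq_abs]
  have hYlt : Y ^ 2 < m := by
    refine lt_of_le_of_ne hYb fun h => hm ⟨Y.natAbs, ?_⟩
    zify
    rw [← h, ← sq, sq_abs]
  have hnz : X ≠ 0 ∨ Y ≠ 0 ∨ Z ≠ 0 := by
    by_contra! h
    apply hne
    simp only [Prod.mk.injEq, Fin.ext_iff]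
    omega
  have hdm : (m : ℤ) ∣ Z ^ 2 + p * Y ^ 2 - m * X ^ 2 := by
    rw [← ZMod.intCast_zmod_eq_zero_iff_dvd]
    have hZY : (Z : ZMod m) = Y := by
      rw [hZ, hY]; push_cast; linear_combination hf.1
    have hp1 : (p : ZMod m) + 1 = 0 := by
      have := (ZMod.natCast_eq_zero_iff (p + 1) m).mpr hpm
      exact_mod_cast this
    push_cast
    rw [hZY, ZMod.natCast_self]
    linear_combination (Y : ZMod m) ^ 2 * hp1
  have hdp : (p : ℤ) ∣ Z ^ 2 + p * Y ^ 2 - m * X ^ 2 := by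
    rw [← ZMod.intCast_zmod_eq_zero_iff_dvd]
    have hZX : (Z : ZMod p) = r * X := by
      rw [hZ, hX]; push_cast; linear_combination hf.2
    push_cast
    rw [hZX, ZMod.natCast_self, hr]
    ring
  have hcop : IsCoprime (m : ℤ) (p : ℤ) :=
    Nat.isCoprime_iff_coprime.mpr ((hp.coprime_iff_not_dvd.mpr
      fun h => absurd (Nat.le_of_dvd hm0 h) hmp.not_ge).symm)
  obtain ⟨k, hk⟩ := hcop.mul_dvd hdm hdp
  have hm' : (0 : ℤ) < m := by exact_mod_cast hm0
  have hp' : (0 : ℤ) < p := by exact_mod_cast hp.pos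
  have hmp' : (0 : ℤ) < m * p := mul_pos hm' hp'
  have h1 : (p : ℤ) * Y ^ 2 < p * m := mul_lt_mul_of_pos_left hYlt hp'
  have h2 : (m : ℤ) * X ^ 2 < m * p := mul_lt_mul_of_pos_left hXlt hm'
  have hk1 : -1 < k := by
    refine lt_of_mul_lt_mul_left ?_ hmp'.le
    have : 0 ≤ (p : ℤ) * Y ^ 2 := by positivity
    linarith [sq_nonneg Z]
  have hk2 : k < 2 := by
    refine lt_of_mul_lt_mul_left ?_ hmp'.le
    have : 0 ≤ (m : ℤ) * X ^ 2 := by positivity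
    linarith
  obtain rfl | rfl : k = 0 ∨ k = 1 := by omega
  · refine ⟨X, Z, Y, ?_, by linear_combination -hk⟩
    rintro rfl
    have hZ0 : Z ^ 2 = 0 := by
      have : 0 ≤ (p : ℤ) * Y ^ 2 := by positivity
      linarith [sq_nonneg Z]
    have hY0 : (p : ℤ) * Y ^ 2 = 0 := by linarith
    have hY1 : Y ^ 2 = 0 := (mul_eq_zero_iff_left hp'.ne').mp hY0
    rcases hnz with h | h | h
    · exact h rfl
    · exact h (pow_eq_zero_iff two_ne_zero |>.mp hY1)
    · exact h (pow_eq_zero_iff two_ne_zero |>.mp hZ0)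
  · refine ⟨X ^ 2 + p, Z * X - p * Y, Z + X * Y, by positivity, ?_⟩
    linear_combination (-(X ^ 2 + (p : ℤ))) * hk

/-- The auxiliary prime of the three-squares theorem, from Dirichlet's theorem and reciprocity. -/
theorem Nat.exists_prime_isSquare_of_mod_four {m : ℕ} (hm : m % 4 = 1 ∨ m % 4 = 2) :
    ∃ p : ℕ, p.Prime ∧ m < p ∧ p % 4 = 1 ∧ m ∣ p + 1 ∧ IsSquare (m : ZMod p) := by
  have hm0 : 0 < m := by omega
  rcases hm with hm | hm
  · -- `p ≡ 2 m - 1 (mod 4 m)`, so `(m / p) = (p / m) = (-1 / m) = 1`.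
    have hcop : IsCoprime (2 * m - 1 : ℤ) ((4 * m : ℕ) : ℤ) := by
      obtain ⟨k, hk⟩ : ∃ k : ℕ, m = 4 * k + 1 := ⟨m / 4, by omega⟩
      refine ⟨2 * m - 1, -(m - 1), ?_⟩
      push_cast
      ring
    obtain ⟨p, hgt, hp, hmod⟩ :=
      Nat.forall_exists_prime_gt_and_zmodEq m (q := 4 * m) (by omega) hcop
    have : Fact p.Prime := ⟨hp⟩
    obtain ⟨j, hj⟩ := hmod.symm.dvd
    push_cast at hj
    have hp4 : p % 4 = 1 := by
      have : (p : ℤ) = 4 * (m * j) + 2 * m - 1 := by linear_combination hj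
      generalize (m : ℤ) * j = w at this
      omega
    have hdvd : m ∣ p + 1 := by
      zify
      exact ⟨4 * j + 2, by linear_combination hj⟩
    refine ⟨p, hp, hgt, hp4, hdvd, ?_⟩
    have hJ : jacobiSym (m : ℤ) p = 1 := by
      rw [jacobiSym.quadratic_reciprocity_one_mod_four hm (Nat.odd_iff.mpr (by omega)),
        jacobiSym.mod_left' (a₂ := -1), jacobiSym.at_neg_one (Nat.odd_iff.mpr (by omega)),
        ZMod.χ₄_nat_one_mod_four hm]
      exact (Int.modEq_iff_dvd.mpr ⟨4 * j + 2, by linear_combination hj⟩ : -1 ≡ (p : ℤ) [ZMOD m]).symm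
    exact_mod_cast ZMod.isSquare_of_jacobiSym_eq_one hJ
  · -- `p = d m - 1` with `d ≡ 1 (mod 4)`, so `(m / p) = (d / p) = (p / d) = (-1 / d) = 1`.
    have hcop : IsCoprime (m - 1 : ℤ) ((4 * m : ℕ) : ℤ) := by
      have h1 : IsCoprime (m - 1 : ℤ) (m : ℤ) := ⟨-1, 1, by ring⟩
      have h2 : IsCoprime (m - 1 : ℤ) (4 : ℤ) := by
        have : IsCoprime (m - 1 : ℤ) (2 : ℤ) :=
          ⟨1, -((m : ℤ) / 2 - 1), by omega⟩
        simpa using this.pow_right (n := 2)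
      push_cast
      exact h2.mul_right h1
    obtain ⟨p, hgt, hp, hmod⟩ :=
      Nat.forall_exists_prime_gt_and_zmodEq m (q := 4 * m) (by omega) hcop
    have : Fact p.Prime := ⟨hp⟩
    obtain ⟨j, hj⟩ := hmod.symm.dvd
    push_cast at hj
    have hp4 : p % 4 = 1 := by
      have : (p : ℤ) = 4 * (m * j) + m - 1 := by linear_combination hj
      generalize (m : ℤ) * j = w at this
      omega
    have hj0 : 0 ≤ j := by
      by_contra hneg
      have h1 : (m : ℤ) * j ≤ m * (-1) := mul_le_mul_of_nonneg_left (by omega) (by positivity)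
      have h2 : (m : ℤ) < p := by exact_mod_cast hgt
      linarith
    lift j to ℕ using hj0
    obtain ⟨d, hd⟩ : ∃ d : ℕ, d = 4 * j + 1 := ⟨_, rfl⟩
    have hdm : (p : ℤ) + 1 = m * d := by rw [hd]; push_cast; linear_combination hj
    refine ⟨p, hp, hgt, hp4, by zify; exact ⟨d, hdm⟩, ?_⟩
    have hJd : jacobiSym (d : ℤ) p = 1 := by
      have hodd : Odd d := Nat.odd_iff.mpr (by omega)
      rw [jacobiSym.quadratic_reciprocity_one_mod_four (by omega) (Nat.odd_iff.mpr (by omega)),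
        jacobiSym.mod_left' (a₂ := -1), jacobiSym.at_neg_one hodd,
        ZMod.χ₄_nat_one_mod_four (by omega)]
      exact (Int.modEq_iff_dvd.mpr ⟨m, by linear_combination hdm⟩ : -1 ≡ (p : ℤ) [ZMOD d]).symm
    have hJ : jacobiSym (m : ℤ) p = 1 := by
      have h : jacobiSym ((m : ℤ) * d) p = 1 := by
        rw [← hdm, jacobiSym.mod_left' (a₂ := 1), jacobiSym.one_left]
        simp
      rwa [jacobiSym.mul_left, hJd, mul_one] at h
    exact_mod_cast ZMod.isSquare_of_jacobiSym_eq_one hJ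

/-- The three-squares theorem for `m ≡ 1, 2 (mod 4)`. -/
theorem Nat.exists_sum_three_sq {m : ℕ} (hm : m % 4 = 1 ∨ m % 4 = 2) :
    ∃ a b c : ℤ, (m : ℤ) = a ^ 2 + b ^ 2 + c ^ 2 := by
  by_cases hsq : IsSquare m
  · obtain ⟨r, rfl⟩ := hsq
    exact ⟨r, 0, 0, by push_cast; ring⟩
  obtain ⟨p, hp, hmp, hp4, hdvd, hres⟩ := Nat.exists_prime_isSquare_of_mod_four hm
  have : Fact p.Prime := ⟨hp⟩
  obtain ⟨e, f, hef⟩ := Nat.Prime.sq_add_sq (p := p) (by omega)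
  obtain ⟨T, U, V, hT, h⟩ :=
    Nat.exists_mul_sq_eq_sq_add_mul_sq hp (by omega) hsq hmp hdvd hres
  refine Int.exists_sum_three_sq_of_mul_sq m T.natAbs (Int.natAbs_pos.mpr hT) U (e * V) (f * V) ?_
  rw [Int.natAbs_sq, h, ← hef]
  push_cast
  ring

/-! ### Factors of sums of two squares -/

/-- A factor `a` of a sum of two squares `a * b` is a sum of two squares if no prime `≡ 3 (mod 4)`
divides both `a` and `b`: such a prime has the same, even, valuation in `a` and in `a * b`. -/
theorem Nat.eq_sq_add_sq_of_mul {a b : ℕ} (ha : a ≠ 0) (hb : b ≠ 0)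
    (hab : ∀ q : ℕ, q.Prime → q % 4 = 3 → q ∣ a → ¬ q ∣ b)
    (h : ∃ x y, a * b = x ^ 2 + y ^ 2) : ∃ x y, a = x ^ 2 + y ^ 2 := by
  rw [Nat.eq_sq_add_sq_iff] at h ⊢
  intro q hq hq4
  have hqp := Nat.prime_of_mem_primeFactors hq
  have hqa := Nat.dvd_of_mem_primeFactors hq
  have : Fact q.Prime := ⟨hqp⟩
  have hev := h q (Nat.mem_primeFactors.mpr ⟨hqp, hqa.mul_right b, mul_ne_zero ha hb⟩) hq4
  rwa [padicValNat.mul ha hb, padicValNat.eq_zero_of_not_dvd (hab q hqp hq4 hqa), add_zero] at hev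

/-- A representation `n² = x² + 4 (e² + f²)` splits `n` into sums of two squares, provided no prime
`≡ 3 (mod 4)` divides both parts. -/
theorem Int.sum_two_sq_of_sq_eq_sq_add_four_mul {n x e f : ℤ} (hn : 0 < n) (hno : Odd n)
    (hx : Odd x) (hef : 0 < e ^ 2 + f ^ 2) (h : n ^ 2 = x ^ 2 + 4 * (e ^ 2 + f ^ 2))
    (hq : ∀ a b q : ℕ, 0 < a → 0 < b → (a + b : ℤ) = n → q.Prime → q % 4 = 3 → q ∣ a → ¬ q ∣ b) :
    ∃ r s t u : ℤ, n = (r ^ 2 + s ^ 2) + (t ^ 2 + u ^ 2) ∧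
      (r ^ 2 + s ^ 2) * (t ^ 2 + u ^ 2) = e ^ 2 + f ^ 2 := by
  have hlt : |x| < |n| := sq_lt_sq.mp (by linarith)
  rw [abs_of_pos hn, abs_lt] at hlt
  obtain ⟨k, rfl⟩ := hno
  obtain ⟨l, rfl⟩ := hx
  obtain ⟨a, ha⟩ := Int.eq_ofNat_of_zero_le (show 0 ≤ k - l by omega)
  obtain ⟨b, hb⟩ := Int.eq_ofNat_of_zero_le (show 0 ≤ k + l + 1 by omega)
  have hab : (a : ℤ) * b = e ^ 2 + f ^ 2 := by rw [← ha, ← hb]; linarith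
  have hab' : a * b = e.natAbs ^ 2 + f.natAbs ^ 2 := by zify; simpa using hab
  have hsum : (a + b : ℤ) = 2 * k + 1 := by omega
  obtain ⟨r, s, hrs⟩ := Nat.eq_sq_add_sq_of_mul (a := a) (b := b) (by omega) (by omega)
    (fun q => hq a b q (by omega) (by omega) hsum) ⟨_, _, hab'⟩
  obtain ⟨t, u, htu⟩ := Nat.eq_sq_add_sq_of_mul (a := b) (b := a) (by omega) (by omega)
    (fun q => hq b a q (by omega) (by omega) (by omega)) ⟨_, _, by rw [mul_comm, hab']⟩
  refine ⟨r, s, t, u, ?_, ?_⟩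
  · rw [← hsum, hrs, htu]; push_cast; ring
  · rw [← hab, hrs, htu]; push_cast; ring

theorem Int.sq_emod_four_cases (x : ℤ) :
    (x % 2 = 0 ∧ x ^ 2 % 4 = 0) ∨ (x % 2 = 1 ∧ x ^ 2 % 4 = 1) := by
  rcases Int.even_or_odd x with h | h
  · obtain ⟨k, rfl⟩ := h
    left
    refine ⟨by omega, ?_⟩
    ring_nf
    omega
  · exact .inr ⟨Int.odd_iff.mp h, Int.sq_mod_four_eq_one_of_odd h⟩

theorem Int.sq_add_sq_emod_four_cases (x y : ℤ) :
    (x ^ 2 + y ^ 2) % 4 = 0 ∨ (x ^ 2 + y ^ 2) % 4 = 1 ∨ (x ^ 2 + y ^ 2) % 4 = 2 := by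
  have := Int.sq_emod_four_cases x
  have := Int.sq_emod_four_cases y
  omega

/-! ### Constructing representations -/

/-- Odd `n ≡ 3 (mod 4)` are represented: in `n = a² + b² + c² + d²` with `d` even and the others odd,
`n = (a² + d²) + (b² + c²)` is the required splitting. -/
theorem Int.exists_sq_eq_sq_add_four_mul {n : ℕ} (hn : n % 4 = 3) :
    ∃ x y z : ℤ, Odd x ∧ Odd y ∧ Odd z ∧ (n : ℤ) ^ 2 = x ^ 2 + 4 * (y ^ 2 + z ^ 2) := by
  have key : ∀ a b c d : ℤ, a % 2 = 1 → b % 2 = 1 → c % 2 = 1 → d % 2 = 0 →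
      (n : ℤ) = a ^ 2 + b ^ 2 + c ^ 2 + d ^ 2 →
      ∃ x y z : ℤ, Odd x ∧ Odd y ∧ Odd z ∧ (n : ℤ) ^ 2 = x ^ 2 + 4 * (y ^ 2 + z ^ 2) := by
    intro a b c d ha hb hc hd h
    rw [← Int.odd_iff] at ha hb hc
    rw [← Int.even_iff] at hd
    refine ⟨a ^ 2 + d ^ 2 - (b ^ 2 + c ^ 2), a * b + d * c, a * c - d * b, ?_, ?_, ?_, ?_⟩
    · exact (ha.pow.add_even (hd.pow_of_ne_zero two_ne_zero)).sub_even (hb.pow.add_odd hc.pow)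
    · exact (ha.mul hb).add_even (hd.mul_right c)
    · exact (ha.mul hc).sub_even (hd.mul_right b)
    · rw [h]; ring
  obtain ⟨a, b, c, d, h⟩ := Nat.sum_four_squares n
  have h' : (n : ℤ) = (a : ℤ) ^ 2 + (b : ℤ) ^ 2 + (c : ℤ) ^ 2 + (d : ℤ) ^ 2 := by
    rw [← h]; push_cast; ring
  rcases Int.sq_emod_four_cases a with ha | ha <;>
  rcases Int.sq_emod_four_cases b with hb | hb <;>
  rcases Int.sq_emod_four_cases c with hc | hc <;>
  rcases Int.sq_emod_four_cases d with hd | hd <;>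
  first
  | (exfalso; omega)
  | exact key a b c d ha.1 hb.1 hc.1 hd.1 h'
  | exact key d b c a hd.1 hb.1 hc.1 ha.1 (by rw [h']; ring)
  | exact key a d c b ha.1 hd.1 hc.1 hb.1 (by rw [h']; ring)
  | exact key a b d c ha.1 hb.1 hd.1 hc.1 (by rw [h']; ring)

theorem Int.exists_sq_eq_sq_add_eight_mul {n : ℤ} (hn1 : 1 < n) (hn : n % 4 = 1) :
    ∃ x y z : ℤ, Odd x ∧ Odd y ∧ Odd z ∧ n ^ 2 = x ^ 2 + 8 * (y ^ 2 + z ^ 2) := by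
  -- `n ≡ 1, 13 (mod 16)` use `u = 3`; `n ≡ 5, 9 (mod 16)` use `u = 1`.
  obtain ⟨u, m, hu, hm, hnm⟩ : ∃ (u : ℤ) (m : ℕ), Odd u ∧ (m % 4 = 1 ∨ m % 4 = 2) ∧
      n = u ^ 2 + 4 * m := by
    by_cases h : n % 16 = 5 ∨ n % 16 = 9
    · exact ⟨1, ((n - 1) / 4).toNat, by decide, by omega, by omega⟩
    · exact ⟨3, ((n - 9) / 4).toNat, by decide, by omega, by omega⟩
  have key : ∀ a b c : ℤ, b % 2 = 1 → c % 2 = 0 → (m : ℤ) = a ^ 2 + b ^ 2 + c ^ 2 →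
      ∃ x y z : ℤ, Odd x ∧ Odd y ∧ Odd z ∧ n ^ 2 = x ^ 2 + 8 * (y ^ 2 + z ^ 2) := by
    intro a b c hb hc h
    rw [← Int.odd_iff] at hb
    rw [← Int.even_iff] at hc
    -- `(u² + (2a)²) (b² + c²) = e² + f²` by the two-squares identity, and
    -- `2 (e² + f²) = (e + f)² + (e - f)²`.
    have he : Odd (u * b - 2 * a * c) := (hu.mul hb).sub_even (hc.mul_left _)
    have hf : Even (u * c + 2 * a * b) :=
      (hc.mul_left _).add (by rw [mul_assoc]; exact even_two_mul _)
    refine ⟨u ^ 2 + 4 * a ^ 2 - 4 * (b ^ 2 + c ^ 2),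
      (u * b - 2 * a * c) + (u * c + 2 * a * b), (u * b - 2 * a * c) - (u * c + 2 * a * b),
      ?_, he.add_even hf, he.sub_even hf, ?_⟩
    · have h4 : ∀ w : ℤ, Even (4 * w) := fun w => ⟨2 * w, by ring⟩
      exact (hu.pow.add_even (h4 _)).sub_even (h4 _)
    · rw [hnm, h]; ring
  obtain ⟨a, b, c, h⟩ := Nat.exists_sum_three_sq hm
  rcases Int.sq_emod_four_cases a with ha | ha <;>
  rcases Int.sq_emod_four_cases b with hb | hb <;>
  rcases Int.sq_emod_four_cases c with hc | hc <;>
  first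
  | (exfalso; omega)
  | exact key a b c hb.1 hc.1 h
  | exact key a c b hc.1 hb.1 (by rw [h]; ring)
  | exact key b a c ha.1 hc.1 (by rw [h]; ring)
  | exact key b c a hc.1 ha.1 (by rw [h]; ring)

/-- Representations by `x² + k (y² + z²)` in odd integers scale by odd factors. -/
theorem Int.exists_sq_eq_sq_add_mul_of_dvd {k d n : ℤ} (hn : Odd n) (hdn : d ∣ n)
    (h : ∃ x y z : ℤ, Odd x ∧ Odd y ∧ Odd z ∧ d ^ 2 = x ^ 2 + k * (y ^ 2 + z ^ 2)) :
    ∃ x y z : ℤ, Odd x ∧ Odd y ∧ Odd z ∧ n ^ 2 = x ^ 2 + k * (y ^ 2 + z ^ 2) := by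
  obtain ⟨c, rfl⟩ := hdn
  obtain ⟨x, y, z, hx, hy, hz, h⟩ := h
  have hc := (Int.odd_mul.mp hn).2
  exact ⟨c * x, c * y, c * z, hc.mul hx, hc.mul hy, hc.mul hz, by rw [mul_pow, h]; ring⟩

/-- An odd `n > 1` that is not a prime `≡ 3 (mod 4)` has a divisor `d > 1` with `d ≡ 1 (mod 4)`. -/
theorem Int.exists_dvd_emod_four_eq_one {n : ℤ} (hno : Odd n) (hn : 1 < n)
    (h : ¬ (Prime n ∧ n ≡ 3 [ZMOD 4])) : ∃ d : ℤ, 1 < d ∧ d % 4 = 1 ∧ d ∣ n := by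
  by_cases h4 : n % 4 = 1
  · exact ⟨n, hn, h4, dvd_rfl⟩
  have hn2 := Int.odd_iff.mp hno
  have h3 : n ≡ 3 [ZMOD 4] := by unfold Int.ModEq; omega
  have hnp : ¬ Prime n := fun hp => h ⟨hp, h3⟩
  lift n to ℕ using by omega
  rw [← Nat.prime_iff_prime_int] at hnp
  obtain ⟨a, b, ha, hb, rfl⟩ := (Nat.not_prime_iff_exists_mul_eq (by omega)).mp hnp
  have ha1 : 1 < a := by
    by_contra hle
    interval_cases a <;> omega
  have hb1 : 1 < b := by
    by_contra hle
    interval_cases b <;> omega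
  have hab : a % 4 = 1 ∨ b % 4 = 1 := by
    have hm : a * b % 4 = 3 := by omega
    rw [Nat.mul_mod] at hm
    have h1 := Nat.mod_lt a (show 4 > 0 by norm_num)
    have h2 := Nat.mod_lt b (show 4 > 0 by norm_num)
    interval_cases a % 4 <;> interval_cases b % 4 <;> simp_all
  rcases hab with h | h
  · exact ⟨a, by omega, by omega, ⟨b, by push_cast; ring⟩⟩
  · exact ⟨b, by omega, by omega, ⟨a, by push_cast; ring⟩⟩

/-! ### The two criteria -/

theorem corollary1p1 :
    (∀ p : ℤ, Odd p → 1 < p →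
      ((Prime p ∧ p ≡ 3 [ZMOD 4]) ↔
        ¬ ∃ x y z : ℤ, Odd x ∧ Odd y ∧ Odd z ∧ p ^ 2 = x ^ 2 + 8 * (y ^ 2 + z ^ 2))) ∧
    (∀ n : ℤ, Odd n → 1 < n →
      ((∀ q : ℕ, q.Prime → (q : ℤ) ∣ n → q ≡ 1 [MOD 4]) ↔
        ¬ ∃ x y z : ℤ, Odd x ∧ Odd y ∧ Odd z ∧ n ^ 2 = x ^ 2 + 4 * (y ^ 2 + z ^ 2))) := by
  refine ⟨fun p hpo hp1 => ⟨?_, fun h => ?_⟩, fun n hno hn1 => ⟨fun hn => ?_, fun h q hq hqn => ?_⟩⟩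
  · rintro ⟨hp, hp3⟩ ⟨x, y, z, hx, hy, hz, h⟩
    have hy2 : y ≠ 0 := by rintro rfl; simp at hy
    obtain ⟨r, s, t, u, hsum, hprod⟩ := Int.sum_two_sq_of_sq_eq_sq_add_four_mul
      (e := y + z) (f := y - z) (by omega) hpo hx
      (by nlinarith [pow_pos (abs_pos.mpr hy2) 2, sq_abs y, sq_nonneg z]) (by rw [h]; ring)
      (fun a b q ha hb hab hq _ hqa hqb => by
        -- A common prime factor of the two parts would equal `p`, which exceeds both.
        have hqp : (q : ℤ) ∣ p := by rw [← hab]; exact_mod_cast dvd_add hqa hqb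
        have := (Int.prime_iff_natAbs_prime.mp hp).eq_one_or_self_of_dvd q
          (Int.natCast_dvd.mp hqp)
        have := Nat.le_of_dvd ha hqa
        have := hq.one_lt
        omega)
    -- The product of the parts is `≡ 4 (mod 8)`, so one part is odd and the other divisible by `4`.
    have hp4 : p % 4 = 3 := hp3
    have h4 : (r ^ 2 + s ^ 2) * (t ^ 2 + u ^ 2) % 4 = 0 := by
      have : (r ^ 2 + s ^ 2) * (t ^ 2 + u ^ 2) = 2 * (y ^ 2 + z ^ 2) := by rw [hprod]; ring
      have := Int.odd_iff.mp hy
      have := Int.odd_iff.mp hz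
      have := Int.sq_emod_four_cases y
      have := Int.sq_emod_four_cases z
      omega
    rw [Int.mul_emod] at h4
    rcases Int.sq_add_sq_emod_four_cases r s with hA | hA | hA <;>
    rcases Int.sq_add_sq_emod_four_cases t u with hB | hB | hB <;>
    rw [hA, hB] at h4 <;> omega
  · by_contra hne
    obtain ⟨d, hd1, hd4, hdp⟩ := Int.exists_dvd_emod_four_eq_one hpo hp1 hne
    exact h (Int.exists_sq_eq_sq_add_mul_of_dvd hpo hdp (Int.exists_sq_eq_sq_add_eight_mul hd1 hd4))
  · rintro ⟨x, y, z, hx, hy, hz, h⟩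
    have hq3 : ∀ q : ℕ, q.Prime → q % 4 = 3 → ¬ (q : ℤ) ∣ n := fun q hq hq3 hqn => by
      have : q % 4 = 1 := hn q hq hqn
      omega
    have hy2 : y ≠ 0 := by rintro rfl; simp at hy
    obtain ⟨r, s, t, u, hsum, hprod⟩ := Int.sum_two_sq_of_sq_eq_sq_add_four_mul
      (by omega) hno hx
      (by positivity) h
      (fun a b q _ _ hab hq hq4 hqa hqb => hq3 q hq hq4
        (by rw [← hab]; exact_mod_cast dvd_add hqa hqb))
    -- `n` is itself a sum of two squares, hence `≡ 1 (mod 4)`.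
    have hn4 : n % 4 = 1 := by
      obtain ⟨e, f, hef⟩ := (Nat.eq_sq_add_sq_iff (n := n.natAbs)).mpr fun q hq hq4 =>
        absurd (Int.natCast_dvd.mpr (Nat.dvd_of_mem_primeFactors hq))
          (hq3 q (Nat.prime_of_mem_primeFactors hq) hq4)
      have hef' : n = (e : ℤ) ^ 2 + (f : ℤ) ^ 2 := by
        rw [← Int.natAbs_of_nonneg (by omega : 0 ≤ n), hef]; push_cast; rfl
      have := Int.odd_iff.mp hno
      have := Int.sq_emod_four_cases e
      have := Int.sq_emod_four_cases f
      omega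
    have h4 : (r ^ 2 + s ^ 2) * (t ^ 2 + u ^ 2) % 4 = 2 := by
      have := Int.sq_emod_four_cases y
      have := Int.sq_emod_four_cases z
      have := Int.odd_iff.mp hy
      have := Int.odd_iff.mp hz
      omega
    rw [Int.mul_emod] at h4
    rcases Int.sq_add_sq_emod_four_cases r s with hA | hA | hA <;>
    rcases Int.sq_add_sq_emod_four_cases t u with hB | hB | hB <;>
    rw [hA, hB] at h4 <;> omega
  · by_contra hq1
    have hqo : q % 2 = 1 := by
      obtain ⟨c, rfl⟩ := hqn
      have := Int.odd_iff.mp (Int.odd_mul.mp hno).1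
      omega
    have hq3 : q % 4 = 3 := by
      unfold Nat.ModEq at hq1
      omega
    exact h (Int.exists_sq_eq_sq_add_mul_of_dvd hno hqn (Int.exists_sq_eq_sq_add_four_mul hq3))
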